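/- Let $X\subset\mathbb C^N$ be a closed irreducible affine variety, $f\colon X\to\mathbb C$ a non-constant function that is the restriction of a polynomial on $\mathbb C^N$, $V\subset X$ a nonsingular locally closed algebraic subset (for instance, a stratum of the canonical Whitney stratification of $X$), and $\ell(x)=\sum_i a_ix_i$ a linear function. Let $$\Gamma_V(\ell,f)=\overline{\operatorname{Sing}(\ell,f)_{|V}\setminus\operatorname{Sing} f_{|V}},\qquad \operatorname{Sing}(\ell,f)_{|V}=\{x\in V\mid \operatorname{rank}\operatorname{Jac}(\ell_{|V},f_{|V})<2\},$$ be the polar locus, and assume that it is an algebraic set of dimension at most $1$ (as is the case for general $\ell$). Embed $\mathbb C^N$ in $\mathbb P^N\times\mathbb P^1$ by $x\mapsto([x;1],f(x))$, and let $H^\infty=\mathbb P^N\setminus\mathbb C^N$. Let $\gamma$ be a branch of $\Gamma_V(\ell,f)$ that tends to a point at infinity $(p,\alpha)\in H^\infty\times\mathbb P^1$, that is, let $s\mapsto \mathbf x_\gamma(s)$ be an injective map from a small punctured disk centred at $0\in\mathbb C$ into $\Gamma_V(\ell,f)$, whose coordinates are Laurent series in $s$ with finitely many negative powers, such that $(\mathbf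 x_\gamma(s),f(\mathbf x_\gamma(s)))\to(p,\alpha)$ as $s\to0$. Assume that $\ell_{|\gamma}(s):=\ell(\mathbf x_\gamma(s))$ is not identically $0$ and does not tend to a finite non-zero limit as $s\to 0$. (This holds whenever $\ell$ does not vanish at $p$, since then $|\ell_{|\gamma}(s)|\to\infty$.) Let $m_\gamma(p,\alpha)$ be the number of points of tangency of $\gamma$ with the fibres of $f_t:=f-t\ell$ which converge to $(p,\alpha)$ as $t\to0$: for every small enough representative of the branch $\gamma$ and every small enough neighbourhood $U$ of $(p,\alpha)$ in $\mathbb P^N\times\mathbb P^1$, it is the number, the same for all $t\neq0$ close enough to $0$, of points $\mathbf x_\gamma(s)\in U$ of this representative at which $d(f-t\ell)(\mathbf x_\gamma'(s))=0$. Let $\operatorname{ord}_0(f_\alpha)_{|\gamma}$ be the order at $0$ of $f(\mathbf x_\gamma(s))-\alpha$ if $\alpha$ is finite, and of $f(\mathbf x_\gamma(s))$ if $\alpha=\infty$. Then $\operatorname{ord}_0(f_\alpha)_{|\gamma}$ and $\operatorname{ord}_0\ell_{|\gamma}$ are finite, the number $m_\gamma(p,\alpha)$ is well defined, and $$m_\gamma(p,\alpha)=\operatorname{ord}_0(f_\alpha)_{|\gamma}-\operatorname{ord}_0\ell_{|\gamma}$$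 if the right-hand side is $\ge0$, while $m_\gamma(p,\alpha)=0$ if the right-hand side is negative. -/

import Mathlib

open Filter Topology
open scoped LinearAlgebra.Projectivization

noncomputable section

namespace PolarMorse

/-! ### Affine varieties, tangent spaces, differentials -/

/-- The smallest Zariski closed subset of affine `N`-space containing `S`. -/
def zariskiClosure {N : ℕ} (S : Set (Fin N → ℂ)) : Set (Fin N → ℂ) :=
  MvPolynomial.zeroLocus ℂ (MvPolynomial.vanishingIdeal ℂ S)

/-- `X` is a closed irreducible affine variety in affine `N`-space. -/
def IsIrreducibleAffineVariety {N : ℕ} (X : Set (Fin N → ℂ)) : Prop :=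
  zariskiClosure X = X ∧ (MvPolynomial.vanishingIdeal ℂ X).IsPrime

/-- The differential of the polynomial `P` at the point `x`, a linear form on `ℂ^N`. -/
def differential {N : ℕ} (P : MvPolynomial (Fin N) ℂ) (x : Fin N → ℂ) :
    (Fin N → ℂ) →ₗ[ℂ] ℂ :=
  ∑ i, MvPolynomial.eval x (MvPolynomial.pderiv i P) • LinearMap.proj i

/-- `V` is a nonsingular locally closed algebraic subset of affine `N`-space (Jacobian criterion):
each point of `V` has a Zariski open neighbourhood `{h ≠ 0}` in which `V` is cut out by finitely
many polynomials whose differentials at that point are linearly independent. -/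
def IsNonsingularLocallyClosed {N : ℕ} (V : Set (Fin N → ℂ)) : Prop :=
  ∀ x ∈ V, ∃ (k : ℕ) (g : Fin k → MvPolynomial (Fin N) ℂ) (h : MvPolynomial (Fin N) ℂ),
    MvPolynomial.eval x h ≠ 0 ∧
    (∀ y, MvPolynomial.eval y h ≠ 0 → (y ∈ V ↔ ∀ i, MvPolynomial.eval y (g i) = 0)) ∧
    LinearIndependent ℂ (fun i => differential (g i) x)

/-- The tangent space of `V` at `x`: the common kernel of the differentials at `x` of all
polynomials vanishing on `V`. -/
def tangentSpaceAt {N : ℕ} (V : Set (Fin N → ℂ)) (x : Fin N → ℂ) :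
    Submodule ℂ (Fin N → ℂ) :=
  ⨅ P ∈ MvPolynomial.vanishingIdeal ℂ V, LinearMap.ker (differential P x)

/-- The differential at `x` of the restriction of the polynomial `P` to `V`. -/
def differentialOn {N : ℕ} (V : Set (Fin N → ℂ)) (P : MvPolynomial (Fin N) ℂ)
    (x : Fin N → ℂ) : tangentSpaceAt V x →ₗ[ℂ] ℂ :=
  (differential P x).domRestrict (tangentSpaceAt V x)

/-! ### The polar locus -/

/-- The linear function `ℓ(x) = ∑ i, a i * x i`, as a polynomial. -/
def linearForm {N : ℕ} (a : Fin N → ℂ) : MvPolynomial (Fin N) ℂ :=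
  ∑ i, MvPolynomial.C (a i) * MvPolynomial.X i

/-- `Sing f|_V`, the set of critical points of the restriction of `F` to `V`. -/
def singOn {N : ℕ} (V : Set (Fin N → ℂ)) (F : MvPolynomial (Fin N) ℂ) :
    Set (Fin N → ℂ) :=
  {x | x ∈ V ∧ differentialOn V F x = 0}

/-- `Sing (ℓ,f)|_V`, the set of points of `V` at which the Jacobian of the restriction of the pair
`(L, F)` to `V` has rank less than `2`. -/
def singPairOn {N : ℕ} (V : Set (Fin N → ℂ)) (L F : MvPolynomial (Fin N) ℂ) :
    Set (Fin N → ℂ) :=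
  {x | x ∈ V ∧ ¬ LinearIndependent ℂ ![differentialOn V L x, differentialOn V F x]}

/-- The polar locus `Γ_V(ℓ,f)`: the closure of `Sing (ℓ,f)|_V ∖ Sing f|_V`. -/
def polarLocus {N : ℕ} (V : Set (Fin N → ℂ)) (L F : MvPolynomial (Fin N) ℂ) :
    Set (Fin N → ℂ) :=
  zariskiClosure (singPairOn V L F \ singOn V F)

/-- The algebraic set with Zariski closed underlying set `Γ` has dimension at most one. -/
def HasDimLEOne {N : ℕ} (Γ : Set (Fin N → ℂ)) : Prop :=
  ringKrullDim (MvPolynomial (Fin N) ℂ ⧸ MvPolynomial.vanishingIdeal ℂ Γ) ≤ 1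

/-! ### Branches at infinity -/

/-- Complex projective space `ℙ^N`, with homogeneous coordinates `[x; x_{N+1}]` where `x ∈ ℂ^N`. -/
abbrev ProjSpace (N : ℕ) : Type := ℙ ℂ ((Fin N → ℂ) × ℂ)

/-- The usual (complex) topology on `ℙ^N`, as a quotient of `ℂ^{N+1} ∖ {0}`. -/
instance projSpaceTopology (N : ℕ) : TopologicalSpace (ProjSpace N) :=
  TopologicalSpace.coinduced
    (fun v : {v : (Fin N → ℂ) × ℂ // v ≠ 0} => Projectivization.mk ℂ v.1 v.2) inferInstance

/-- The standard embedding `ℂ^N → ℙ^N`, `x ↦ [x; 1]`. -/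
def toProj {N : ℕ} (x : Fin N → ℂ) : ProjSpace N :=
  Projectivization.mk ℂ (x, (1 : ℂ)) (fun h => one_ne_zero (congrArg Prod.snd h))

/-- The hyperplane at infinity `{x_{N+1} = 0}`. -/
def hyperplaneAtInfinity (N : ℕ) : Set (ProjSpace N) := {p | p.rep.2 = 0}

/-- The completed graph embedding `x ↦ ([x; 1], f(x))` of `ℂ^N` into `ℙ^N × ℙ^1`; the projective
line `ℙ^1` is the one-point compactification of `ℂ`. -/
def graphEmbedding {N : ℕ} (F : MvPolynomial (Fin N) ℂ) (x : Fin N → ℂ) :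
    ProjSpace N × OnePoint ℂ :=
  (toProj x, ((MvPolynomial.eval x F : ℂ) : OnePoint ℂ))

/-- `γ` is a primitive Laurent parametrization, on a small punctured disk around `0`, of a branch
of the algebraic curve `Γ`: its coordinates are Laurent series with finitely many negative
terms, it is injective near `0`, and it takes values in `Γ`. -/
structure IsBranchParametrization {N : ℕ} (Γ : Set (Fin N → ℂ)) (γ : ℂ → Fin N → ℂ) :
    Prop where
  meromorphic : ∀ i, MeromorphicAt (fun s => γ s i) 0
  injective : ∃ ρ : ℝ, 0 < ρ ∧ Set.InjOn γ {s | 0 < ‖s‖ ∧ ‖s‖ < ρ}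
  mem : ∀ᶠ s in 𝓝[≠] (0 : ℂ), γ s ∈ Γ

/-- The order at `0` of `φ - lim φ` if the limit `α` of `φ` is finite, and of `φ` if it is
infinite. -/
def orderRelLimit (φ : ℂ → ℂ) : OnePoint ℂ → WithTop ℤ
  | OnePoint.infty => meromorphicOrderAt φ 0
  | OnePoint.some c => meromorphicOrderAt (fun s => φ s - c) 0

/-! ### Tangency points -/

/-- At parameter `s`, the curve `γ` is tangent to the fibre of the polynomial `G` through `γ s`:
the differential of `G` at `γ s` kills the velocity vector of `γ`. -/
def IsTangentToFibre {N : ℕ} (G : MvPolynomial (Fin N) ℂ) (γ : ℂ → Fin N → ℂ) (s : ℂ) : Prop :=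
  differential G (γ s) (fun i => deriv (fun z => γ z i) s) = 0

/-- The points of tangency, lying in the set `U` of `ℙ^N × ℙ^1`, of the representative
`γ {0 < |s| < ρ}` of the branch `γ` with the fibres of `f_t = f - t ℓ`. -/
def tangencyPoints {N : ℕ} (L F : MvPolynomial (Fin N) ℂ) (γ : ℂ → Fin N → ℂ) (ρ : ℝ)
    (U : Set (ProjSpace N × OnePoint ℂ)) (t : ℂ) : Set (Fin N → ℂ) :=
  {x | graphEmbedding F x ∈ U ∧
    ∃ s : ℂ, 0 < ‖s‖ ∧ ‖s‖ < ρ ∧ γ s = x ∧ IsTangentToFibre (F - MvPolynomial.C t * L) γ s}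

/-- `m` is the number of points of tangency of the branch `γ` with the fibres of `f_t = f - t ℓ`
which converge to `P` as `t → 0`: for every small representative of the branch and every small
neighbourhood `U` of `P`, there are exactly `m` such points in `U` for all small `t ≠ 0`. -/
def HasTangencyNumber {N : ℕ} (L F : MvPolynomial (Fin N) ℂ) (γ : ℂ → Fin N → ℂ)
    (P : ProjSpace N × OnePoint ℂ) (m : ℕ) : Prop :=
  ∀ᶠ ρ in 𝓝[>] (0 : ℝ), ∃ U₀ ∈ 𝓝 P, ∀ U ∈ 𝓝 P, U ⊆ U₀ →
    ∀ᶠ t in 𝓝[≠] (0 : ℂ), (tangencyPoints L F γ ρ U t).encard = m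

/-- The number of points of tangency is unique. -/
theorem HasTangencyNumber.unique {N : ℕ} {L F : MvPolynomial (Fin N) ℂ} {γ : ℂ → Fin N → ℂ}
    {P : ProjSpace N × OnePoint ℂ} {m m' : ℕ} (h : HasTangencyNumber L F γ P m)
    (h' : HasTangencyNumber L F γ P m') : m = m' := by
  obtain ⟨ρ, ⟨U, hU, h1⟩, ⟨U', hU', h2⟩⟩ := (Filter.Eventually.and h h').exists
  have hi := Filter.inter_mem hU hU'
  obtain ⟨t, h3, h4⟩ :=
    ((h1 _ hi Set.inter_subset_left).and (h2 _ hi Set.inter_subset_right)).exists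
  exact_mod_cast h3.symm.trans h4

end PolarMorse

end

/-!
Write `φ` and `lam` for the restrictions of `f` and `ℓ` to the branch `γ`. By the chain rule
(`isTangentToFibre_sub_iff`), `γ` is tangent at `s` to a fibre of `f - t ℓ` exactly when
`φ' s = t * lam' s`, so the tangency points are the solutions of `q s = t` for the meromorphic germ
`q = φ' / lam'`.

The order of `lam` is nonzero because `lam` has no finite nonzero limit, and the order of `φ`
relative to its limit is nonzero because `φ - α` tends to `0` or `φ` has a pole. In characteristic
zero differentiation lowers both by one, so `q` has order `u - v`. If this order is positive, `q`
is a power `w ^ (u - v)` of a local coordinate (`exists_local_power_form`) and takes every small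
nonzero value exactly `u - v` times, at points tending to the puncture
(`eventually_encard_setOf_eq_of_pos_order`). If it is at most zero, `q` is bounded away from zero
and takes no small value (`eventually_ne_of_order_nonpos`).

The geometric input is that `φ` is not constant, so that `u` is finite
(`not_eventually_deriv_eval_eq_zero`). The polynomials vanishing along the germ of `γ` form a prime
ideal; it is not maximal because `γ` is injective, so, the polar locus having dimension at most one,
it is a minimal prime over the ideal of the polar locus. Hence the set
`Sing (ℓ, f)|_V \ Sing f|_V` meets every nonempty open part of the closure of the germ
(`exists_mem_eval_ne_zero_of_mem_minimalPrimes`). At points of that set `dℓ` is a combination of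
`df` and of the differentials of the equations of `V`. If `φ` were constant, `γ'` would be killed by
all of these but not by `dℓ`; comparing ranks at the generic point and at such a special point,
through the minors of Jacobian matrices, gives a contradiction.
-/

noncomputable section

namespace PolarMorse

/-! ### Value distribution of a meromorphic germ -/

theorem encard_setOf_pow_eq {m : ℕ} (hm : m ≠ 0) {t : ℂ} (ht : t ≠ 0) :
    {z : ℂ | z ^ m = t}.encard = m := by
  classical
  have hζ := Complex.isPrimitiveRoot_exp m hm
  obtain ⟨c, hc⟩ := IsAlgClosed.exists_pow_nat_eq t (Nat.pos_of_ne_zero hm)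
  have h : {z : ℂ | z ^ m = t} = (Polynomial.nthRootsFinset m t : Set ℂ) := by
    ext z
    simp [Polynomial.mem_nthRootsFinset (Nat.pos_of_ne_zero hm)]
  rw [h, Set.encard_coe_eq_coe_finsetCard, Polynomial.nthRootsFinset_def,
    Multiset.toFinset_card_of_nodup (hζ.nthRoots_nodup ht), hζ.card_nthRoots, if_pos ⟨c, hc⟩]

/-- A meromorphic germ with a zero of order `m` is, up to a local homeomorphism fixing `0`, the map
`w ↦ w ^ m`. -/
theorem exists_local_power_form {q : ℂ → ℂ} {m : ℕ} (hm : m ≠ 0)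
    (hq : meromorphicOrderAt q 0 = ((m : ℤ) : WithTop ℤ)) :
    ∃ (e : OpenPartialHomeomorph ℂ ℂ), (0 : ℂ) ∈ e.source ∧ e 0 = 0 ∧
      ∀ᶠ s in 𝓝[≠] (0 : ℂ), q s = e s ^ m := by
  have hmer : MeromorphicAt q 0 :=
    meromorphicAt_of_meromorphicOrderAt_ne_zero (by rw [hq]; exact_mod_cast hm)
  obtain ⟨g, hg, hg0, hqg⟩ := (meromorphicOrderAt_eq_int_iff hmer).1 hq
  obtain ⟨c, hc⟩ := IsAlgClosed.exists_pow_nat_eq (g 0) (Nat.pos_of_ne_zero hm)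
  have hc0 : c ≠ 0 := by
    rintro rfl
    exact hg0 (by rw [← hc, zero_pow hm])
  -- an analytic `m`-th root of `g`; dividing by `g 0` keeps the base of the power near `1`
  set h : ℂ → ℂ := fun s => c * (g s / g 0) ^ ((m : ℂ)⁻¹) with hh
  have han : AnalyticAt ℂ h 0 := by
    refine analyticAt_const.mul (AnalyticAt.cpow (hg.div analyticAt_const hg0) analyticAt_const ?_)
    simp [div_self hg0]
  have hh0 : h 0 = c := by simp [hh, div_self hg0]
  have hhm : ∀ s, h s ^ m = g s := by
    intro s
    simp only [hh]
    rw [mul_pow, hc, Complex.cpow_nat_inv_pow _ hm, mul_div_cancel₀ _ hg0]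
  have hw : HasStrictDerivAt (fun s => s * h s) c 0 := by
    have := (hasStrictDerivAt_id (0 : ℂ)).mul han.hasStrictDerivAt
    rw [hh0, id, zero_mul, one_mul, add_zero] at this
    exact this
  let e := (hw.hasStrictFDerivAt_equiv hc0).toOpenPartialHomeomorph (fun s => s * h s)
  have hes : ∀ s, e s = s * h s := fun s => rfl
  refine ⟨e, (hw.hasStrictFDerivAt_equiv hc0).mem_toOpenPartialHomeomorph_source,
    by simp [hes], ?_⟩
  filter_upwards [hqg] with s hs
  rw [hs, hes, mul_pow, hhm]
  simp

/-- A meromorphic germ with a zero of order `m` takes each small nonzero value exactly `m` times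
near its zero. -/
theorem eventually_encard_setOf_eq_of_pos_order {q : ℂ → ℂ} {m : ℕ} (hm : m ≠ 0)
    (hq : meromorphicOrderAt q 0 = ((m : ℤ) : WithTop ℤ)) :
    ∀ᶠ ρ in 𝓝[>] (0 : ℝ), ∀ D ∈ 𝓝[≠] (0 : ℂ), ∀ᶠ t in 𝓝[≠] (0 : ℂ),
      {s : ℂ | 0 < ‖s‖ ∧ ‖s‖ < ρ ∧ s ∈ D ∧ q s = t}.encard = m := by
  obtain ⟨e, h0, he0, hqe⟩ := exists_local_power_form hm hq
  have hgood : ∀ᶠ s in 𝓝 (0 : ℂ), s ∈ e.source ∧ (s ≠ 0 → q s = e s ^ m) :=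
    Eventually.and (e.open_source.mem_nhds h0) (eventually_nhdsWithin_iff.1 hqe)
  obtain ⟨ρ₀, hρ₀, hball⟩ := Metric.eventually_nhds_iff.1 hgood
  filter_upwards [Ioo_mem_nhdsGT hρ₀] with ρ hρ D hD
  have hB : ∀ {s : ℂ}, ‖s‖ < ρ → s ∈ e.source ∧ (s ≠ 0 → q s = e s ^ m) := fun {s} hs =>
    hball (by simpa using hs.trans hρ.2)
  -- the inverse of `e` brings every small value into `D` and into the disk of radius `ρ`
  have hsymm : ∀ᶠ z in 𝓝 (0 : ℂ), z ∈ e.target ∧ ‖e.symm z‖ < ρ ∧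
      (e.symm z ≠ 0 → e.symm z ∈ D) := by
    have ht : (0 : ℂ) ∈ e.target := he0 ▸ e.map_source h0
    have hs0 : e.symm 0 = 0 := by rw [← he0, e.left_inv h0, he0]
    have hc : Tendsto e.symm (𝓝 0) (𝓝 0) := by
      simpa [hs0] using (e.continuousAt_symm ht).tendsto
    have hDρ : ∀ᶠ w in 𝓝 (0 : ℂ), ‖w‖ < ρ ∧ (w ≠ 0 → w ∈ D) :=
      ((continuous_norm.tendsto' 0 0 norm_zero).eventually_lt_const hρ.1).and
      (eventually_nhdsWithin_iff.1 hD)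
    exact Eventually.and (e.open_target.mem_nhds ht) (hc.eventually hDρ)
  obtain ⟨ε, hε, hεb⟩ := Metric.eventually_nhds_iff.1 hsymm
  have hsmall : ∀ᶠ t in 𝓝[≠] (0 : ℂ), ‖t‖ < ε ^ m := by
    exact eventually_nhdsWithin_of_eventually_nhds
      ((continuous_norm.tendsto' 0 0 norm_zero).eventually_lt_const (pow_pos hε m))
  filter_upwards [hsmall, eventually_mem_nhdsWithin] with t htε ht0
  rw [← encard_setOf_pow_eq hm ht0]
  have hinj : Set.InjOn e {s : ℂ | 0 < ‖s‖ ∧ ‖s‖ < ρ ∧ s ∈ D ∧ q s = t} :=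
    e.injOn.mono fun s hs => (hB hs.2.1).1
  rw [← hinj.encard_image]
  congr 1
  ext z
  constructor
  · rintro ⟨s, ⟨hs0, hsρ, -, hst⟩, rfl⟩
    exact ((hB hsρ).2 (norm_pos_iff.1 hs0)).symm.trans hst
  · intro hz
    have hz : z ^ m = t := hz
    have hzε : ‖z‖ < ε := by
      refine lt_of_pow_lt_pow_left₀ m hε.le ?_
      rwa [← norm_pow, hz]
    obtain ⟨hzt, hzρ, hzD⟩ := hεb (y := z) (by simpa using hzε)
    have hz0 : e.symm z ≠ 0 := by
      intro h
      have : z = 0 := by rw [← e.right_inv hzt, h, he0]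
      rw [this, zero_pow hm] at hz
      exact ht0 hz.symm
    refine ⟨e.symm z, ⟨norm_pos_iff.2 hz0, hzρ, hzD hz0, ?_⟩, e.right_inv hzt⟩
    rw [(hB hzρ).2 hz0, e.right_inv hzt, hz]

/-- A meromorphic germ of order at most zero is bounded away from zero. -/
theorem eventually_ne_of_order_nonpos {q : ℂ → ℂ} (hmer : MeromorphicAt q 0)
    (hq : meromorphicOrderAt q 0 ≤ 0) :
    ∀ᶠ ρ in 𝓝[>] (0 : ℝ), ∀ᶠ t in 𝓝[≠] (0 : ℂ), ∀ s : ℂ, 0 < ‖s‖ → ‖s‖ < ρ → q s ≠ t := by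
  have hbd : ∃ ε > (0 : ℝ), ∀ᶠ s in 𝓝[≠] (0 : ℂ), ε ≤ ‖q s‖ := by
    rcases hq.lt_or_eq with h | h
    · have := tendsto_norm_atTop_iff_cobounded.2 (tendsto_cobounded_of_meromorphicOrderAt_neg h)
      exact ⟨1, one_pos, this.eventually_ge_atTop 1⟩
    · obtain ⟨c, hc, hlim⟩ := tendsto_ne_zero_of_meromorphicOrderAt_eq_zero hmer h
      have hpos := norm_pos_iff.2 hc
      exact ⟨‖c‖ / 2, by positivity, hlim.norm.eventually_const_le (by linarith)⟩
  obtain ⟨ε, hε, h⟩ := hbd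
  obtain ⟨ρ₀, hρ₀, hball⟩ := Metric.eventually_nhds_iff.1 (eventually_nhdsWithin_iff.1 h)
  filter_upwards [Ioo_mem_nhdsGT hρ₀] with ρ hρ
  have hsmall : ∀ᶠ t in 𝓝[≠] (0 : ℂ), ‖t‖ < ε := by
    exact eventually_nhdsWithin_of_eventually_nhds
      ((continuous_norm.tendsto' 0 0 norm_zero).eventually_lt_const hε)
  filter_upwards [hsmall] with t ht s hs hsρ hqs
  have := hball (y := s) (by simpa using hsρ.trans hρ.2) (norm_pos_iff.1 hs)
  rw [hqs] at this
  linarith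

/-! ### Linear independence of differentials through minors -/

theorem exists_det_submatrix_ne_zero {K : Type*} [Field K] {k N : ℕ}
    (A : Matrix (Fin k) (Fin N) K) (hA : LinearIndependent K A.row) :
    ∃ e : Fin k → Fin N, (A.submatrix id e).det ≠ 0 := by
  by_contra! h
  have hinj : Function.Injective A.transpose.mulVec :=
    Matrix.mulVec_injective_iff.2 (by rwa [Matrix.col_transpose])
  obtain ⟨g, hg⟩ := A.transpose.mulVecLin.exists_leftInverse_of_injective
    (LinearMap.ker_eq_bot.2 hinj)
  have hB : LinearMap.toMatrix' g * A.transpose = 1 := by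
    rw [← LinearMap.toMatrix'_toLin' A.transpose, Matrix.toLin'_apply', ← LinearMap.toMatrix'_comp, hg,
      LinearMap.toMatrix'_id]
  -- expand `det (B * Aᵀ)` along the rows of `Aᵀ`: it is a combination of the minors of `A`
  have hdet : (LinearMap.toMatrix' g * A.transpose).det = 0 := by
    have hrow : (LinearMap.toMatrix' g * A.transpose) =
        fun i => ∑ j, LinearMap.toMatrix' g i j • A.transpose j := by
      ext i l
      simp [Matrix.mul_apply, Finset.sum_apply]
    rw [hrow]
    change Matrix.detRowAlternating.toMultilinearMap _ = 0
    rw [MultilinearMap.map_sum]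
    refine Finset.sum_eq_zero fun e _ => ?_
    rw [MultilinearMap.map_smul_univ]
    have : (Matrix.detRowAlternating.toMultilinearMap fun i => A.transpose (e i)) =
        (A.submatrix id e).transpose.det := rfl
    rw [this, Matrix.det_transpose, h e, smul_zero]
  rw [hB, Matrix.det_one] at hdet
  exact one_ne_zero hdet

theorem differential_apply {N : ℕ} (P : MvPolynomial (Fin N) ℂ) (x w : Fin N → ℂ) :
    differential P x w = ∑ i, MvPolynomial.eval x (MvPolynomial.pderiv i P) * w i := by
  simp [differential]

/-- The maximal minor, on the columns `e` of the Jacobian matrix of `Q`, as a polynomial. -/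
def jacobianMinor {k N : ℕ} (Q : Fin k → MvPolynomial (Fin N) ℂ) (e : Fin k → Fin N) :
    MvPolynomial (Fin N) ℂ :=
  (Matrix.of fun i j => MvPolynomial.pderiv (e j) (Q i)).det

theorem eval_jacobianMinor {k N : ℕ} (Q : Fin k → MvPolynomial (Fin N) ℂ) (e : Fin k → Fin N)
    (x : Fin N → ℂ) :
    MvPolynomial.eval x (jacobianMinor Q e) =
      (Matrix.of fun i j => MvPolynomial.eval x (MvPolynomial.pderiv (e j) (Q i))).det := by
  rw [jacobianMinor, RingHom.map_det]
  rfl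

theorem linearIndependent_differential_iff {k N : ℕ} (Q : Fin k → MvPolynomial (Fin N) ℂ)
    (x : Fin N → ℂ) :
    LinearIndependent ℂ (fun i => differential (Q i) x) ↔
      ∃ e : Fin k → Fin N, MvPolynomial.eval x (jacobianMinor Q e) ≠ 0 := by
  simp only [eval_jacobianMinor]
  constructor
  · intro h
    refine exists_det_submatrix_ne_zero
      (Matrix.of fun i j => MvPolynomial.eval x (MvPolynomial.pderiv j (Q i))) ?_
    rw [Fintype.linearIndependent_iff] at h ⊢
    refine fun c hc => h c ?_
    ext j
    simpa [differential_apply, Pi.single_apply] using congrFun hc j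
  · rintro ⟨e, he⟩
    rw [Fintype.linearIndependent_iff]
    intro c hc
    refine congrFun (Matrix.eq_zero_of_vecMul_eq_zero he (v := c) ?_)
    ext j
    simpa [differential_apply, Pi.single_apply, Matrix.vecMul, dotProduct] using
      LinearMap.congr_fun hc (Pi.single (e j) 1)

/-! ### Critical points on `V` -/

/-- At a point where `L` and `F` are dependent on `V` but `F` is not critical, the differential of
`L` is a combination of that of `F` and of those of the equations of `V`. -/
theorem differential_mem_span_of_mem_singPairOn {N : ℕ} {V : Set (Fin N → ℂ)}
    {L F : MvPolynomial (Fin N) ℂ} {x : Fin N → ℂ} (hx : x ∈ singPairOn V L F \ singOn V F) :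
    differential L x ∈ Submodule.span ℂ
      ((fun P => differential P x) '' insert F (MvPolynomial.vanishingIdeal ℂ V : Set _)) := by
  obtain ⟨⟨hxV, hdep⟩, hcrit⟩ := hx
  have hF : differentialOn V F x ≠ 0 := fun h => hcrit ⟨hxV, h⟩
  obtain ⟨c, hc⟩ : ∃ c : ℂ, c • differentialOn V F x = differentialOn V L x := by
    by_contra! h
    refine hdep (LinearIndependent.pair_symm_iff.1 ((LinearIndependent.pair_iff' hF).2 h))
  set W : Submodule ℂ (Module.Dual ℂ (Fin N → ℂ)) := Submodule.span ℂ
    ((fun P => differential P x) '' (MvPolynomial.vanishingIdeal ℂ V : Set _)) with hW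
  have hmem : differential L x - c • differential F x ∈ W := by
    rw [← Subspace.dualCoannihilator_dualAnnihilator_eq (W := W), Submodule.mem_dualAnnihilator]
    intro w hw
    have hwT : w ∈ tangentSpaceAt V x := by
      simp only [tangentSpaceAt, Submodule.mem_iInf, LinearMap.mem_ker]
      intro P hP
      exact (Submodule.mem_dualCoannihilator w).1 hw _ (Submodule.subset_span ⟨P, hP, rfl⟩)
    have := LinearMap.congr_fun hc ⟨w, hwT⟩
    simp only [differentialOn, LinearMap.smul_apply, LinearMap.domRestrict_apply] at this
    simp [← this]
  rw [Set.image_insert_eq, Submodule.mem_span_insert]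
  exact ⟨c, _, hmem, by abel⟩

/-! ### Polynomials along a meromorphic curve -/

theorem hasDerivAt_eval {N : ℕ} (P : MvPolynomial (Fin N) ℂ) {γ : ℂ → Fin N → ℂ} {s : ℂ}
    (hγ : ∀ i, DifferentiableAt ℂ (fun z => γ z i) s) :
    HasDerivAt (fun z => MvPolynomial.eval (γ z) P)
      (differential P (γ s) fun i => deriv (fun z => γ z i) s) s := by
  induction P using MvPolynomial.induction_on with
  | C a => simpa [differential_apply] using hasDerivAt_const s a
  | add P Q hP hQ =>
    have hf : (fun z => MvPolynomial.eval (γ z) (P + Q)) =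
        (fun z => MvPolynomial.eval (γ z) P) + fun z => MvPolynomial.eval (γ z) Q := by
      ext z
      simp
    rw [hf]
    refine (hP.add hQ).congr_deriv ?_
    simp [differential_apply, add_mul, Finset.sum_add_distrib]
  | mul_X P j hP =>
    have hf : (fun z => MvPolynomial.eval (γ z) (P * MvPolynomial.X j)) =
        (fun z => MvPolynomial.eval (γ z) P) * fun z => γ z j := by
      ext z
      simp
    rw [hf]
    refine (hP.mul (hγ j).hasDerivAt).congr_deriv ?_
    simp only [differential_apply, Derivation.leibniz, MvPolynomial.pderiv_X, smul_eq_mul,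
      map_add, map_mul, MvPolynomial.eval_X, add_mul, Finset.sum_add_distrib, Finset.sum_mul]
    rw [add_comm]
    congr 1
    · rw [Finset.sum_eq_single j]
      · simp
      · intro i _ hi
        simp [hi.symm]
      · simp
    · exact Finset.sum_congr rfl fun i _ => by ring

theorem meromorphicAt_eval {N : ℕ} (P : MvPolynomial (Fin N) ℂ) {γ : ℂ → Fin N → ℂ} {z : ℂ}
    (hγ : ∀ i, MeromorphicAt (fun s => γ s i) z) :
    MeromorphicAt (fun s => MvPolynomial.eval (γ s) P) z := by
  induction P using MvPolynomial.induction_on with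
  | C a => simp
  | add P Q hP hQ => simpa using hP.fun_add hQ
  | mul_X P j hP => simpa using hP.fun_mul (hγ j)

theorem eventually_hasDerivAt_eval {N : ℕ} {γ : ℂ → Fin N → ℂ}
    (hγ : ∀ i, MeromorphicAt (fun s => γ s i) 0) :
    ∀ᶠ s in 𝓝[≠] (0 : ℂ), ∀ P : MvPolynomial (Fin N) ℂ,
      HasDerivAt (fun z => MvPolynomial.eval (γ z) P)
        (differential P (γ s) fun i => deriv (fun z => γ z i) s) s := by
  filter_upwards [eventually_all.2 fun i => (hγ i).eventually_analyticAt] with s hs P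
  exact hasDerivAt_eval P fun i => (hs i).differentiableAt

/-! ### The ideal of a germ of a curve -/

/-- The ideal of polynomials vanishing along the germ of the curve `γ` at the puncture `0`. -/
def germIdeal {N : ℕ} (γ : ℂ → Fin N → ℂ) : Ideal (MvPolynomial (Fin N) ℂ) where
  carrier := {P | ∀ᶠ s in 𝓝[≠] (0 : ℂ), MvPolynomial.eval (γ s) P = 0}
  zero_mem' := by simp
  add_mem' {P Q} hP hQ := by
    change ∀ᶠ s in 𝓝[≠] (0 : ℂ), MvPolynomial.eval (γ s) (P + Q) = 0
    have hP' : ∀ᶠ s in 𝓝[≠] (0 : ℂ), MvPolynomial.eval (γ s) P = 0 := hP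
    have hQ' : ∀ᶠ s in 𝓝[≠] (0 : ℂ), MvPolynomial.eval (γ s) Q = 0 := hQ
    refine (hP'.and hQ').mono fun s h => ?_
    rw [map_add, h.1, h.2, add_zero]
  smul_mem' P Q hQ := by
    change ∀ᶠ s in 𝓝[≠] (0 : ℂ), MvPolynomial.eval (γ s) (P • Q) = 0
    have hQ' : ∀ᶠ s in 𝓝[≠] (0 : ℂ), MvPolynomial.eval (γ s) Q = 0 := hQ
    refine hQ'.mono fun s h => ?_
    rw [smul_eq_mul, map_mul, h, mul_zero]

theorem mem_germIdeal {N : ℕ} {γ : ℂ → Fin N → ℂ} {P : MvPolynomial (Fin N) ℂ} :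
    P ∈ germIdeal γ ↔ ∀ᶠ s in 𝓝[≠] (0 : ℂ), MvPolynomial.eval (γ s) P = 0 := Iff.rfl

theorem eventually_ne_zero_of_notMem_germIdeal {N : ℕ} {γ : ℂ → Fin N → ℂ}
    (hγ : ∀ i, MeromorphicAt (fun s => γ s i) 0) {P : MvPolynomial (Fin N) ℂ}
    (hP : P ∉ germIdeal γ) : ∀ᶠ s in 𝓝[≠] (0 : ℂ), MvPolynomial.eval (γ s) P ≠ 0 :=
  (meromorphicAt_eval P hγ).eventually_eq_zero_or_eventually_ne_zero.resolve_left hP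

theorem germIdeal_isPrime {N : ℕ} {γ : ℂ → Fin N → ℂ}
    (hγ : ∀ i, MeromorphicAt (fun s => γ s i) 0) : (germIdeal γ).IsPrime := by
  refine ⟨fun h => ?_, fun {P Q} hPQ => ?_⟩
  · have h1 : (1 : MvPolynomial (Fin N) ℂ) ∈ germIdeal γ := h ▸ Submodule.mem_top
    obtain ⟨s, hs⟩ := (mem_germIdeal.1 h1).exists
    simp at hs
  · by_contra! h
    obtain ⟨s, h0, hP, hQ⟩ := ((mem_germIdeal.1 hPQ).and
      ((eventually_ne_zero_of_notMem_germIdeal hγ h.1).and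
        (eventually_ne_zero_of_notMem_germIdeal hγ h.2))).exists
    rw [map_mul] at h0
    exact (mul_ne_zero hP hQ) h0

/-- The germ of an injective curve does not lie in a point. -/
theorem germIdeal_not_isMaximal {N : ℕ} {γ : ℂ → Fin N → ℂ} {ρ : ℝ} (hρ : 0 < ρ)
    (hinj : Set.InjOn γ {s | 0 < ‖s‖ ∧ ‖s‖ < ρ}) : ¬ (germIdeal γ).IsMaximal := by
  intro hmax
  obtain ⟨x, hx⟩ := MvPolynomial.isMaximal_iff_eq_vanishingIdeal_singleton.1 hmax
  have hconst : ∀ᶠ s in 𝓝[≠] (0 : ℂ), γ s = x := by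
    have : ∀ i, ∀ᶠ s in 𝓝[≠] (0 : ℂ), γ s i = x i := by
      intro i
      have hi : MvPolynomial.X i - MvPolynomial.C (x i) ∈ germIdeal γ := by
        rw [hx, MvPolynomial.mem_vanishingIdeal_singleton_iff]
        simp
      filter_upwards [mem_germIdeal.1 hi] with s hs
      simpa [sub_eq_zero] using hs
    filter_upwards [eventually_all.2 this] with s hs
    exact funext hs
  obtain ⟨ε, hε, hball⟩ := Metric.eventually_nhds_iff.1 (eventually_nhdsWithin_iff.1 hconst)
  have hδ : 0 < min ε ρ := lt_min hε hρ
  have key : ∀ r : ℝ, 0 < r → r < min ε ρ → γ (r : ℂ) = x ∧ 0 < ‖(r : ℂ)‖ ∧ ‖(r : ℂ)‖ < ρ := by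
    intro r hr hr'
    have hn : ‖(r : ℂ)‖ = r := by simp [hr.le]
    refine ⟨hball ?_ ?_, by rwa [hn], by rw [hn]; exact hr'.trans_le (min_le_right _ _)⟩
    · rw [dist_zero_right, hn]
      exact hr'.trans_le (min_le_left _ _)
    · simpa using hr.ne'
  obtain ⟨h1, h1'⟩ := key (min ε ρ / 2) (by linarith) (by linarith)
  obtain ⟨h2, h2'⟩ := key (min ε ρ / 3) (by linarith) (by linarith)
  have := hinj h1' h2' (h1.trans h2.symm)
  have : min ε ρ / 2 = min ε ρ / 3 := by exact_mod_cast this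
  linarith

/-! ### Components of a one-dimensional Zariski closure -/

/-- In dimension at most one, an irreducible closed subset that is not a point is a component. -/
theorem mem_minimalPrimes_of_ringKrullDim_quotient_le_one {R : Type*} [CommRing R] {I P : Ideal R}
    [hP : P.IsPrime] (hIP : I ≤ P) (hmax : ¬ P.IsMaximal) (hdim : ringKrullDim (R ⧸ I) ≤ 1) :
    P ∈ I.minimalPrimes := by
  rw [ringKrullDim_quotient, Order.krullDim_le_one_iff] at hdim
  rcases hdim ⟨⟨P, hP⟩, hIP⟩ with h | h
  · refine ⟨⟨hP, hIP⟩, fun Q hQ hQP => ?_⟩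
    exact h (b := ⟨⟨Q, hQ.1⟩, hQ.2⟩) hQP
  · obtain ⟨M, hM, hPM⟩ := P.exists_le_maximal hP.ne_top
    have hMP : M ≤ P := h (b := ⟨⟨M, hM.isPrime⟩, hIP.trans hPM⟩) hPM
    exact absurd (le_antisymm hPM hMP ▸ hM) hmax

/-- An irreducible component of `Spec (R ⧸ I)`, for `R` Noetherian, has a nonempty part cut out by
`a ≠ 0` that no other component meets. -/
theorem exists_notMem_forall_le_of_mem_minimalPrimes {R : Type*} [CommRing R] [IsNoetherianRing R]
    {I P : Ideal R} (hP : P ∈ I.minimalPrimes) :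
    ∃ a ∉ P, ∀ Q : Ideal R, Q.IsPrime → I ≤ Q → a ∉ Q → P ≤ Q := by
  classical
  have hfin := I.finite_minimalPrimes_of_isNoetherianRing R
  set T := hfin.toFinset.erase P with hT
  have hnot : ¬ T.inf id ≤ P := by
    intro h
    obtain ⟨Q, hQT, hQP⟩ := (hP.1.1.inf_le').1 h
    rw [hT, Finset.mem_erase, Set.Finite.mem_toFinset] at hQT
    exact hQT.1 (le_antisymm hQP (hP.2 hQT.2.1 hQP))
  obtain ⟨a, haT, haP⟩ := SetLike.not_le_iff_exists.1 hnot
  refine ⟨a, haP, fun Q hQ hIQ haQ => ?_⟩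
  obtain ⟨Q', hQ', hQQ'⟩ := Ideal.exists_minimalPrimes_le hIQ
  rcases eq_or_ne Q' P with rfl | hne
  · exact hQQ'
  · have hmem : Q' ∈ T := by simp [hT, hne, hQ']
    exact absurd (hQQ' (Finset.inf_le (f := id) hmem haT)) haQ

/-- A set meets each nonempty open part of each irreducible component of its Zariski closure. -/
theorem exists_mem_eval_ne_zero_of_mem_minimalPrimes {N : ℕ} {S : Set (Fin N → ℂ)}
    {P : Ideal (MvPolynomial (Fin N) ℂ)}
    (hP : P ∈ (MvPolynomial.vanishingIdeal ℂ S).minimalPrimes)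
    {b : MvPolynomial (Fin N) ℂ} (hb : b ∉ P) :
    ∃ x ∈ S, MvPolynomial.eval x b ≠ 0 ∧ ∀ g ∈ P, MvPolynomial.eval x g = 0 := by
  obtain ⟨a, haP, ha⟩ := exists_notMem_forall_le_of_mem_minimalPrimes hP
  have hab : a * b ∉ MvPolynomial.vanishingIdeal ℂ S := fun h =>
    (hP.1.1.mem_or_mem (hP.1.2 h)).elim haP hb
  simp only [MvPolynomial.mem_vanishingIdeal_iff, not_forall] at hab
  obtain ⟨x, hxS, hx⟩ := hab
  rw [map_mul] at hx
  have hle : P ≤ MvPolynomial.vanishingIdeal ℂ {x} := by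
    refine ha _ (Ideal.IsMaximal.isPrime' _) (MvPolynomial.vanishingIdeal_anti_mono (by simpa)) ?_
    rw [MvPolynomial.mem_vanishingIdeal_singleton_iff]
    exact left_ne_zero_of_mul hx
  refine ⟨x, hxS, right_ne_zero_of_mul hx, fun g hg => ?_⟩
  exact (MvPolynomial.mem_vanishingIdeal_singleton_iff x g).1 (hle hg)

theorem vanishingIdeal_zariskiClosure {N : ℕ} (S : Set (Fin N → ℂ)) :
    MvPolynomial.vanishingIdeal ℂ (zariskiClosure S) = MvPolynomial.vanishingIdeal ℂ S :=
  le_antisymm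
    (MvPolynomial.vanishingIdeal_anti_mono (MvPolynomial.zeroLocus_vanishingIdeal_le S))
    (MvPolynomial.le_vanishingIdeal_zeroLocus _)

/-! ### Generic rank along the branch -/

theorem exists_linearIndependent_of_forall_mem_span {K E : Type*} [Field K] [AddCommGroup E]
    [Module K E] [FiniteDimensional K E] {n : ℕ} {A : Set E} {w : Fin n → E}
    (hw : LinearIndependent K w) (h : ∀ i, w i ∈ Submodule.span K A) :
    ∃ u : Fin n → E, (∀ i, u i ∈ A) ∧ LinearIndependent K u := by
  obtain ⟨κ, a, ha, hspan, hli⟩ := exists_linearIndependent' K ((↑) : A → E)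
  have := hli.finite
  have := Fintype.ofFinite κ
  have hw' : LinearIndependent K fun i => (⟨w i, h i⟩ : Submodule.span K A) :=
    LinearIndependent.of_comp (Submodule.span K A).subtype hw
  have hcard : Fintype.card (Fin n) ≤ Fintype.card κ := by
    refine hw'.fintype_card_le_finrank.trans (le_of_eq ?_)
    rw [← finrank_span_eq_card hli, hspan, Subtype.range_coe]
  obtain ⟨f⟩ := Function.Embedding.nonempty_of_card_le hcard
  exact ⟨fun i => (a (f i) : E), fun i => (a (f i)).2, hli.comp f f.injective⟩

theorem exists_jacobianMinor_notMem_germIdeal {k N : ℕ} {Q : Fin k → MvPolynomial (Fin N) ℂ}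
    {γ : ℂ → Fin N → ℂ}
    (h : ∃ᶠ s in 𝓝[≠] (0 : ℂ), LinearIndependent ℂ fun i => differential (Q i) (γ s)) :
    ∃ e, jacobianMinor Q e ∉ germIdeal γ := by
  by_contra! hmem
  refine h ?_
  filter_upwards [eventually_all.2 fun e => mem_germIdeal.1 (hmem e)] with s hs
  rw [linearIndependent_differential_iff]
  push Not
  exact hs

theorem eventually_linearIndependent_differential {k N : ℕ} {Q : Fin k → MvPolynomial (Fin N) ℂ}
    {γ : ℂ → Fin N → ℂ} (hγ : ∀ i, MeromorphicAt (fun s => γ s i) 0) {e : Fin k → Fin N}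
    (he : jacobianMinor Q e ∉ germIdeal γ) :
    ∀ᶠ s in 𝓝[≠] (0 : ℂ), LinearIndependent ℂ fun i => differential (Q i) (γ s) := by
  filter_upwards [eventually_ne_zero_of_notMem_germIdeal hγ he] with s hs
  exact (linearIndependent_differential_iff Q (γ s)).2 ⟨e, hs⟩

/-- There is a generic rank `r` of the differentials of the members of `A` along the germ of `γ`:
some `r` of them are independent at points tending to the puncture, while all minors of size `r + 1`
vanish along the germ. -/
theorem exists_maximal_generic_rank {N : ℕ} (A : Set (MvPolynomial (Fin N) ℂ))
    (γ : ℂ → Fin N → ℂ) :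
    ∃ r : ℕ,
      (∃ Q : Fin r → MvPolynomial (Fin N) ℂ, (∀ i, Q i ∈ A) ∧
        ∃ᶠ s in 𝓝[≠] (0 : ℂ), LinearIndependent ℂ fun i => differential (Q i) (γ s)) ∧
      ∀ Q : Fin (r + 1) → MvPolynomial (Fin N) ℂ, (∀ i, Q i ∈ A) →
        ∀ e, jacobianMinor Q e ∈ germIdeal γ := by
  by_contra! hcon
  have hall : ∀ r : ℕ, ∃ Q : Fin r → MvPolynomial (Fin N) ℂ, (∀ i, Q i ∈ A) ∧
      ∃ᶠ s in 𝓝[≠] (0 : ℂ), LinearIndependent ℂ fun i => differential (Q i) (γ s) := by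
    intro r
    induction r with
    | zero =>
      exact ⟨Fin.elim0, fun i => i.elim0,
        (Eventually.of_forall fun s => linearIndependent_empty_type).frequently⟩
    | succ r ih =>
      obtain ⟨Q, hQ, e, he⟩ := hcon r ih
      refine ⟨Q, hQ, ?_⟩
      rw [mem_germIdeal, not_eventually] at he
      exact he.mono fun s hs => (linearIndependent_differential_iff Q (γ s)).2 ⟨e, hs⟩
  obtain ⟨Q, -, hQ⟩ := hall (N + 1)
  obtain ⟨s, hs⟩ := hQ.exists
  have := LinearIndependent.fintype_card_le_finrank (M := Module.Dual ℂ (Fin N → ℂ)) hs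
  rw [Subspace.dual_finrank_eq] at this
  simp at this

/-- Let the closure of the germ of `γ` be a component of the polar locus. If `L` is not constant
along `γ`, neither is `F`.

Otherwise the velocity of `γ` would separate the differential of `L` from the span `W` of the
differentials of `F` and of the equations of `V`. Adding the differential of `L` to `W` would then
raise the generic rank `r`. At points of `Sing (L, F)|_V` outside `Sing F|_V` the differential of
`L` lies in `W`; such a point lies on the closure of the germ and avoids the zeros of a minor of
size `r + 1`, so `W` has rank larger than `r` there, although rank can only drop under
specialization. -/
theorem not_eventually_deriv_eval_eq_zero {N : ℕ} {V : Set (Fin N → ℂ)}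
    {L F : MvPolynomial (Fin N) ℂ} {γ : ℂ → Fin N → ℂ}
    (hγ : ∀ i, MeromorphicAt (fun s => γ s i) 0)
    (hmin : germIdeal γ ∈
      (MvPolynomial.vanishingIdeal ℂ (singPairOn V L F \ singOn V F)).minimalPrimes)
    (hL : ∀ᶠ s in 𝓝[≠] (0 : ℂ), deriv (fun z => MvPolynomial.eval (γ z) L) s ≠ 0) :
    ¬ ∀ᶠ s in 𝓝[≠] (0 : ℂ), deriv (fun z => MvPolynomial.eval (γ z) F) s = 0 := by
  intro hF
  set A : Set (MvPolynomial (Fin N) ℂ) :=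
    insert F (MvPolynomial.vanishingIdeal ℂ V : Set (MvPolynomial (Fin N) ℂ)) with hA
  have hderiv := eventually_hasDerivAt_eval hγ
  have hkill : ∀ P ∈ A, ∀ᶠ s in 𝓝[≠] (0 : ℂ),
      deriv (fun z => MvPolynomial.eval (γ z) P) s = 0 := by
    rintro P (rfl | hP)
    · exact hF
    · have hmem : P ∈ germIdeal γ :=
        hmin.1.2 (MvPolynomial.vanishingIdeal_anti_mono (fun x hx => hx.1.1) hP)
      have hzero : (fun z => MvPolynomial.eval (γ z) P) =ᶠ[𝓝[≠] 0] fun _ => (0 : ℂ) := hmem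
      filter_upwards [hzero.nhdsNE_deriv] with s hs
      simpa using hs
  -- `r` is the generic rank along `γ` of the differentials of `F` and of the equations of `V`
  obtain ⟨r, ⟨Q, hQA, hQ⟩, hmax⟩ := exists_maximal_generic_rank A γ
  obtain ⟨e, he⟩ := exists_jacobianMinor_notMem_germIdeal hQ
  have hcons : ∀ x, (fun i => differential ((Fin.cons L Q : Fin (r + 1) → _) i) x) =
      (Fin.cons (differential L x) fun i => differential (Q i) x :
        Fin (r + 1) → Module.Dual ℂ (Fin N → ℂ)) := by
    intro x
    ext1 i
    refine Fin.cases ?_ (fun j => ?_) i <;> simp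
  -- the velocity of `γ` is killed by the differentials of the `Q i` but not by that of `L`
  have hLQ : ∀ᶠ s in 𝓝[≠] (0 : ℂ), LinearIndependent ℂ
      fun i => differential ((Fin.cons L Q : Fin (r + 1) → _) i) (γ s) := by
    filter_upwards [eventually_linearIndependent_differential hγ he, hderiv, hL,
      eventually_all.2 fun i => hkill (Q i) (hQA i)] with s h1 h2 h3 h4
    rw [hcons, linearIndependent_finCons]
    refine ⟨h1, fun hspan => h3 ?_⟩
    rw [(h2 L).deriv]
    have hle : Submodule.span ℂ (Set.range fun i => differential (Q i) (γ s)) ≤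
        LinearMap.ker (Module.Dual.eval ℂ (Fin N → ℂ) fun i => deriv (fun z => γ z i) s) := by
      rw [Submodule.span_le]
      rintro _ ⟨i, rfl⟩
      have := h4 i
      rwa [(h2 (Q i)).deriv] at this
    exact hle hspan
  obtain ⟨e', he'⟩ := exists_jacobianMinor_notMem_germIdeal hLQ.frequently
  obtain ⟨x, hxS, hx, hx0⟩ := exists_mem_eval_ne_zero_of_mem_minimalPrimes hmin he'
  have hLx := (linearIndependent_differential_iff _ x).2 ⟨e', hx⟩
  -- at `x` the differentials of members of `A` have rank larger than their generic rank `r`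
  obtain ⟨u, huA, hu⟩ := exists_linearIndependent_of_forall_mem_span
    (A := (fun P => differential P x) '' A) hLx (by
      intro i
      refine Fin.cases ?_ (fun j => ?_) i
      · exact differential_mem_span_of_mem_singPairOn hxS
      · exact Submodule.subset_span ⟨Q j, hQA j, by simp⟩)
  choose R hRA hR using huA
  have hR' : LinearIndependent ℂ fun i => differential (R i) x := by
    have : (fun i => differential (R i) x) = u := funext hR
    rwa [this]
  obtain ⟨e'', he''⟩ := (linearIndependent_differential_iff R x).1 hR'
  exact he'' (hx0 _ (hmax R hRA e''))

/-! ### Orders of the restrictions and tangency points -/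

/-- If `φ` tends to `α` and is not locally constant, the order of `φ` relative to its limit is a
nonzero integer, and differentiation lowers it by one. -/
theorem exists_orderRelLimit_eq {φ : ℂ → ℂ} (hφ : MeromorphicAt φ 0) {α : OnePoint ℂ}
    (hlim : Tendsto (fun s => (φ s : OnePoint ℂ)) (𝓝[≠] (0 : ℂ)) (𝓝 α))
    (hderiv : ¬ ∀ᶠ s in 𝓝[≠] (0 : ℂ), deriv φ s = 0) :
    ∃ u : ℤ, orderRelLimit φ α = (u : WithTop ℤ) ∧
      meromorphicOrderAt (deriv φ) 0 = ((u - 1 : ℤ) : WithTop ℤ) := by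
  induction α using OnePoint.rec with
  | infty =>
    have hcob : Tendsto φ (𝓝[≠] (0 : ℂ)) (Bornology.cobounded ℂ) := by
      rw [Metric.cobounded_eq_cocompact, ← Filter.coclosedCompact_eq_cocompact,
        ← OnePoint.comap_coe_nhds_infty]
      exact tendsto_comap_iff.2 hlim
    have hneg := (tendsto_cobounded_iff_meromorphicOrderAt_neg hφ).1 hcob
    obtain ⟨u, hu⟩ := WithTop.ne_top_iff_exists.1 hneg.ne_top
    have hu0 : u ≠ 0 := by
      rintro rfl
      rw [← hu] at hneg
      exact lt_irrefl _ hneg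
    exact ⟨u, hu.symm, meromorphicOrderAt_deriv_eq_sub_one (by exact_mod_cast hu0) hu.symm⟩
  | coe c =>
    have hc : Tendsto φ (𝓝[≠] (0 : ℂ)) (𝓝 c) :=
      OnePoint.isOpenEmbedding_coe.isInducing.tendsto_nhds_iff.2 hlim
    have hm : MeromorphicAt (fun s => φ s - c) 0 := hφ.fun_sub (MeromorphicAt.const c 0)
    have hpos : 0 < meromorphicOrderAt (fun s => φ s - c) 0 := by
      rw [← tendsto_zero_iff_meromorphicOrderAt_pos hm]
      simpa using hc.sub_const c
    have htop : meromorphicOrderAt (fun s => φ s - c) 0 ≠ ⊤ := by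
      intro h
      have h0 : (fun s => φ s - c) =ᶠ[𝓝[≠] 0] fun _ => (0 : ℂ) := meromorphicOrderAt_eq_top_iff.1 h
      refine hderiv ?_
      filter_upwards [h0.nhdsNE_deriv] with s hs
      simpa using hs
    obtain ⟨u, hu⟩ := WithTop.ne_top_iff_exists.1 htop
    have hu0 : u ≠ 0 := by
      rintro rfl
      rw [← hu] at hpos
      exact lt_irrefl _ hpos
    refine ⟨u, hu.symm, ?_⟩
    have := meromorphicOrderAt_deriv_eq_sub_one (by exact_mod_cast hu0) hu.symm
    rwa [show deriv (fun s => φ s - c) = deriv φ from funext fun s => deriv_sub_const c] at this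

/-- The order of `g` is a nonzero integer, since order zero would mean a finite nonzero limit; so
differentiation lowers it by one. -/
theorem exists_order_eq_of_not_tendsto {g : ℂ → ℂ} (hg : MeromorphicAt g 0)
    (hzero : ¬ ∀ᶠ s in 𝓝[≠] (0 : ℂ), g s = 0)
    (hlim : ∀ c : ℂ, c ≠ 0 → ¬ Tendsto g (𝓝[≠] (0 : ℂ)) (𝓝 c)) :
    ∃ v : ℤ, meromorphicOrderAt g 0 = (v : WithTop ℤ) ∧
      meromorphicOrderAt (deriv g) 0 = ((v - 1 : ℤ) : WithTop ℤ) := by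
  have htop : meromorphicOrderAt g 0 ≠ ⊤ := fun h => hzero (meromorphicOrderAt_eq_top_iff.1 h)
  obtain ⟨v, hv⟩ := WithTop.ne_top_iff_exists.1 htop
  have hv0 : v ≠ 0 := by
    rintro rfl
    obtain ⟨c, hc, h⟩ := tendsto_ne_zero_of_meromorphicOrderAt_eq_zero hg hv.symm
    exact hlim c hc h
  exact ⟨v, hv.symm, meromorphicOrderAt_deriv_eq_sub_one (by exact_mod_cast hv0) hv.symm⟩

/-- By the chain rule, tangency to a fibre of `F - t * L` means that the quotient of the
derivatives of `F` and `L` along `γ` takes the value `t`. -/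
theorem isTangentToFibre_sub_iff {N : ℕ} {L F : MvPolynomial (Fin N) ℂ} {γ : ℂ → Fin N → ℂ}
    {s t : ℂ}
    (hderiv : ∀ P : MvPolynomial (Fin N) ℂ, HasDerivAt (fun z => MvPolynomial.eval (γ z) P)
      (differential P (γ s) fun i => deriv (fun z => γ z i) s) s)
    (hL : deriv (fun z => MvPolynomial.eval (γ z) L) s ≠ 0) :
    IsTangentToFibre (F - MvPolynomial.C t * L) γ s ↔
      deriv (fun z => MvPolynomial.eval (γ z) F) s /
        deriv (fun z => MvPolynomial.eval (γ z) L) s = t := by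
  rw [div_eq_iff hL, (hderiv F).deriv, (hderiv L).deriv, IsTangentToFibre, ← sub_eq_zero (b := t * _)]
  simp [differential_apply, sub_mul, Finset.sum_sub_distrib, Finset.mul_sum, mul_assoc]

theorem eventually_tangencyPoints_eq_image {N : ℕ} {L F : MvPolynomial (Fin N) ℂ}
    {γ : ℂ → Fin N → ℂ} (hγ : ∀ i, MeromorphicAt (fun s => γ s i) 0)
    (hL : ∀ᶠ s in 𝓝[≠] (0 : ℂ), deriv (fun z => MvPolynomial.eval (γ z) L) s ≠ 0) :
    ∀ᶠ ρ in 𝓝[>] (0 : ℝ), ∀ U t, tangencyPoints L F γ ρ U t =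
      γ '' {s | 0 < ‖s‖ ∧ ‖s‖ < ρ ∧ s ∈ (fun z => graphEmbedding F (γ z)) ⁻¹' U ∧
        deriv (fun z => MvPolynomial.eval (γ z) F) s /
          deriv (fun z => MvPolynomial.eval (γ z) L) s = t} := by
  obtain ⟨ρ₀, hρ₀, hball⟩ := Metric.eventually_nhds_iff.1
    (eventually_nhdsWithin_iff.1 ((eventually_hasDerivAt_eval hγ).and hL))
  filter_upwards [Ioo_mem_nhdsGT hρ₀] with ρ hρ U t
  have hiff : ∀ s : ℂ, 0 < ‖s‖ → ‖s‖ < ρ → (IsTangentToFibre (F - MvPolynomial.C t * L) γ s ↔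
      deriv (fun z => MvPolynomial.eval (γ z) F) s /
        deriv (fun z => MvPolynomial.eval (γ z) L) s = t) := by
    intro s hs0 hs
    obtain ⟨h1, h2⟩ := hball (y := s) (by simpa using hs.trans hρ.2) (norm_pos_iff.1 hs0)
    exact isTangentToFibre_sub_iff h1 h2
  ext x
  constructor
  · rintro ⟨hU, s, hs0, hs, rfl, ht⟩
    exact ⟨s, ⟨hs0, hs, hU, (hiff s hs0 hs).1 ht⟩, rfl⟩
  · rintro ⟨s, ⟨hs0, hs, hU, ht⟩, rfl⟩
    exact ⟨hU, s, hs0, hs, rfl, (hiff s hs0 hs).2 ht⟩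

end PolarMorse

end

theorem proposition4p2 {N : ℕ}
    (X : Set (Fin N → ℂ)) (_hX : PolarMorse.IsIrreducibleAffineVariety X)
    (F : MvPolynomial (Fin N) ℂ)
    (_hF : ¬ ∃ c : ℂ, ∀ x ∈ X, MvPolynomial.eval x F = c)
    (V : Set (Fin N → ℂ)) (_hVX : V ⊆ X) (hV : PolarMorse.IsNonsingularLocallyClosed V)
    (a : Fin N → ℂ)
    (hΓ : PolarMorse.HasDimLEOne (PolarMorse.polarLocus V (PolarMorse.linearForm a) F))
    (γ : ℂ → Fin N → ℂ)
    (hγ : PolarMorse.IsBranchParametrization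
      (PolarMorse.polarLocus V (PolarMorse.linearForm a) F) γ)
    (p : PolarMorse.ProjSpace N) (hp : p ∈ PolarMorse.hyperplaneAtInfinity N)
    (α : OnePoint ℂ)
    (hlim : Tendsto (fun s => PolarMorse.graphEmbedding F (γ s)) (𝓝[≠] (0 : ℂ)) (𝓝 (p, α)))
    (hℓ_zero : ¬ ∀ᶠ s in 𝓝[≠] (0 : ℂ),
      MvPolynomial.eval (γ s) (PolarMorse.linearForm a) = 0)
    (hℓ_lim : ∀ c : ℂ, c ≠ 0 →
      ¬ Tendsto (fun s => MvPolynomial.eval (γ s) (PolarMorse.linearForm a))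
        (𝓝[≠] (0 : ℂ)) (𝓝 c)) :
    ∃ u v : ℤ,
      PolarMorse.orderRelLimit (fun s => MvPolynomial.eval (γ s) F) α = (u : WithTop ℤ) ∧
      meromorphicOrderAt (fun s => MvPolynomial.eval (γ s) (PolarMorse.linearForm a)) 0
        = (v : WithTop ℤ) ∧
      (0 ≤ u - v →
        ∃ m : ℕ, (m : ℤ) = u - v ∧
          PolarMorse.HasTangencyNumber (PolarMorse.linearForm a) F γ (p, α) m) ∧
      (u - v < 0 →
        PolarMorse.HasTangencyNumber (PolarMorse.linearForm a) F γ (p, α) 0) := by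
  open PolarMorse in
  obtain ⟨hmer, ⟨ρ₁, hρ₁, hinj⟩, hmem⟩ := hγ
  have hφm := meromorphicAt_eval F hmer
  have hlm := meromorphicAt_eval (linearForm a) hmer
  obtain ⟨v, hv, hv'⟩ := exists_order_eq_of_not_tendsto hlm hℓ_zero hℓ_lim
  have hL : ∀ᶠ s in 𝓝[≠] (0 : ℂ),
      deriv (fun z => MvPolynomial.eval (γ z) (linearForm a)) s ≠ 0 := by
    rw [← meromorphicOrderAt_ne_top_iff_eventually_ne_zero hlm.deriv, hv']
    exact WithTop.coe_ne_top
  have hmin : germIdeal γ ∈ (MvPolynomial.vanishingIdeal ℂ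
      (singPairOn V (linearForm a) F \ singOn V F)).minimalPrimes := by
    have := germIdeal_isPrime hmer
    rw [HasDimLEOne, polarLocus, vanishingIdeal_zariskiClosure] at hΓ
    refine mem_minimalPrimes_of_ringKrullDim_quotient_le_one (fun P hP => ?_)
      (germIdeal_not_isMaximal hρ₁ hinj) hΓ
    filter_upwards [hmem] with s hs
    exact hs P hP
  obtain ⟨u, hu, hu'⟩ := exists_orderRelLimit_eq hφm ((continuous_snd.tendsto _).comp hlim)
    (not_eventually_deriv_eval_eq_zero hmer hmin hL)
  -- points of tangency with the fibres of `F - t * L` are the points where `q` takes the value `t`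
  set q : ℂ → ℂ := fun s => deriv (fun z => MvPolynomial.eval (γ z) F) s /
    deriv (fun z => MvPolynomial.eval (γ z) (linearForm a)) s with hq
  have hqm : MeromorphicAt q 0 := hφm.deriv.fun_div hlm.deriv
  have hqo : meromorphicOrderAt q 0 = ((u - v : ℤ) : WithTop ℤ) := by
    have h := fun_meromorphicOrderAt_div hφm.deriv hlm.deriv
    rw [hu', hv'] at h
    rw [hq, h]
    norm_cast
    ring_nf
  have himage := eventually_tangencyPoints_eq_image (F := F) hmer hL
  have hnone : u - v ≤ 0 → HasTangencyNumber (linearForm a) F γ (p, α) 0 := by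
    intro hle
    filter_upwards [himage, eventually_ne_of_order_nonpos hqm (by rw [hqo]; exact_mod_cast hle)]
      with ρ h1 h2
    refine ⟨Set.univ, univ_mem, fun U _ _ => ?_⟩
    filter_upwards [h2] with t ht
    rw [h1, Nat.cast_zero, Set.encard_eq_zero, Set.image_eq_empty, Set.eq_empty_iff_forall_notMem]
    exact fun s hs => ht s hs.1 hs.2.1 hs.2.2.2
  refine ⟨u, v, hu, hv, fun hle => ?_, fun hlt => hnone hlt.le⟩
  obtain ⟨m, hm⟩ := Int.eq_ofNat_of_zero_le hle
  refine ⟨m, hm.symm, ?_⟩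
  rcases eq_or_ne m 0 with rfl | hm0
  · exact hnone (by omega)
  rw [hm] at hqo
  filter_upwards [himage, eventually_encard_setOf_eq_of_pos_order hm0 hqo, Ioo_mem_nhdsGT hρ₁]
    with ρ h1 h2 hρ
  refine ⟨Set.univ, univ_mem, fun U hU _ => ?_⟩
  filter_upwards [h2 _ (hlim hU)] with t ht
  rw [h1]
  refine (Set.InjOn.encard_image ?_).trans ht
  intro s hs s' hs' h
  exact hinj ⟨hs.1, hs.2.1.trans hρ.2⟩ ⟨hs'.1, hs'.2.1.trans hρ.2⟩ h
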